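/- Let $I=\{0=t_0<t_1<\dots<t_N=T\}$ and let $\mathcal K\subset\mathbb R^d$ be compact. For a real Hilbert space $H$ put $\widetilde H=\{\mathbf h\in\prod_{n\ge0}H^{\hat\otimes n}:\sum_n\|\mathbf h_n\|^2<\infty\}$, where $H^{\hat\otimes n}$ is the Hilbert tensor power, and for a path $x:I\to H$ define its time-augmented signature $$S_H(x)=\prod_{i=0}^N\exp_\otimes\big(t_i-t_{i-1},\,x_{t_i}-x_{t_{i-1}}\big)\in\widetilde{\mathbb R\oplus H},\qquad t_{-1}:=0,\ x_{t_{-1}}:=0,$$ where $\exp_\otimes(v)=\sum_{n\ge0}v^{\otimes n}/n!$ and the product is the tensor product, taken in increasing order of $i$. Let $\mathcal H^1=\widetilde{\mathbb R\oplus\mathbb R^d}$, $\mathcal H^2=\widetilde{\mathbb R\oplus\mathcal H^1}$, and $S=S_{\mathbb R^d}:(\mathbb R^d)^I\to\mathcal H^1$. For a path $\mu=(\mu_t)_{t\in I}$ of probability measures on $\mathcal K^I$ let $\bar\mu_t=\int S(x)\,\mu_t(dx)\in\mathcal H^1$ and $S^2(\mu)=S_{\mathcal H^1}(t\mapsto\bar\mu_t)\in\mathcal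 H^2$. Let $(\Omega,\mathcal F,\mathbb P)$ and $(\Omega',\mathcal G,\mathbb Q)$ be probability spaces with filtrations $(\mathcal F_t)_{t\in I}$ and $(\mathcal G_t)_{t\in I}$, and let $X=(X_t)_{t\in I}$ and $Y=(Y_t)_{t\in I}$ be $\mathcal K$-valued processes on them, adapted to these filtrations. Let $\hat X^1_t=\mathbb P[X\in\cdot\mid\mathcal F_t]$ and $\hat Y^1_t=\mathbb Q[Y\in\cdot\mid\mathcal G_t]$, $t\in I$ (regular conditional distributions of the whole path), be their rank-1 prediction processes. Then the expectations $\mathbb E_{\mathbb P}[S(X)]$, $\mathbb E_{\mathbb Q}[S(Y)]$ in $\mathcal H^1$ and $\mathbb E_{\mathbb P}[S^2(\hat X^1)]$, $\mathbb E_{\mathbb Q}[S^2(\hat Y^1)]$ in $\mathcal H^2$ exist as Bochner integrals, and $$\mathcal L(X)=\mathcal L(Y)\iff\mathbb E_{\mathbb P}[S(X)]=\mathbb E_{\mathbb Q}[S(Y)],$$ $$\mathcal L(\hat X^1)=\mathcal L(\hat Y^1)\iff\mathbb E_{\mathbb P}[S^2(\hat X^1)]=\mathbb E_{\mathbb Q}[S^2(\hat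 Y^1)].$$ -/

import Mathlib

open MeasureTheory ProbabilityTheory
open scoped ENNReal Nat

namespace RankTwoSignature

noncomputable section

/-- `ℓ²(A)`: the real Hilbert space with orthonormal basis indexed by `A`. -/
abbrev EllTwo (A : Type*) : Type _ := lp (fun _ : A => ℝ) 2

/-- The Hilbert space `{h ∈ ∏ₙ H^{⊗̂n} : ∑ₙ ‖hₙ‖² < ∞}` for `H = ℓ²(A)`.  The completed tensor power
`H^{⊗̂n}` has the orthonormal basis `e_{a₁} ⊗ ⋯ ⊗ e_{aₙ}`, indexed by the words `[a₁, …, aₙ]` of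
length `n`, so an element is given by its coefficients on all words, and its squared norm is the
sum of the squares of all these coefficients. -/
abbrev TensorHilbert (A : Type*) : Type _ := EllTwo (List A)

/-- The tensor exponential `∑ₙ v^{⊗n} / n!`: the coefficient at `[a₁, …, aₙ]` is
`v a₁ ⋯ v aₙ / n!`. -/
def tensorExp {A : Type*} (v : A → ℝ) (w : List A) : ℝ :=
  (w.map v).prod / (w.length)!

/-- The unit `1 ∈ H^{⊗0} = ℝ` of the tensor algebra. -/
def tensorOne {A : Type*} (w : List A) : ℝ :=
  if w.length = 0 then 1 else 0

/-- The tensor (concatenation) product: the coefficient at `w` is the sum of `f u * g v` over all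
splittings of `w` as a word `u` followed by a word `v`. -/
def tensorMul {A : Type*} (f g : List A → ℝ) (w : List A) : ℝ :=
  ∑ k ∈ Finset.range (w.length + 1), f (w.take k) * g (w.drop k)

/-- The increments `x₀ - 0, x₁ - x₀, …, x_N - x_{N-1}` of a discrete path. -/
def increment {E : Type*} [AddGroup E] {N : ℕ} (x : Fin (N + 1) → E) (i : Fin (N + 1)) : E :=
  Fin.cases (x 0) (fun j : Fin N => x j.succ - x j.castSucc) i

/-- The vector `(s, h) ∈ ℝ ⊕ ℓ²(A) = ℓ²(Option A)`; `none` is the coordinate of `ℝ`. -/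
def augment {A : Type*} (s : ℝ) (h : EllTwo A) : Option A → ℝ :=
  fun o => o.elim s fun a => h a

/-- The coefficients of the time-augmented signature
`∏_{i=0}^N exp_⊗ (tᵢ - tᵢ₋₁, xᵢ - xᵢ₋₁)`, with `t₋₁ = 0` and `x₋₁ = 0`; the factors are multiplied
in increasing order of `i` from left to right. -/
def signatureCoeff {A : Type*} {N : ℕ} (t : Fin (N + 1) → ℝ) (x : Fin (N + 1) → EllTwo A) :
    List (Option A) → ℝ :=
  (List.ofFn fun i => tensorExp (augment (increment t i) (increment x i))).foldr
    tensorMul tensorOne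

/-! The coefficients of a signature are square-summable. -/

/-- Square-summability with all exponential weights in the word length. -/
def StronglySummable {A : Type*} (f : List A → ℝ) : Prop :=
  ∀ R : ℝ, 0 < R → Summable fun w => R ^ w.length * f w ^ 2

theorem summable_sq {A : Type*} (x : EllTwo A) : Summable fun a => x a ^ 2 := by
  have h := (memℓp_gen_iff (p := 2) (by norm_num)).1 (lp.memℓp x)
  simpa using h

theorem summable_augment {A : Type*} (s : ℝ) (x : EllTwo A) :
    Summable fun o => augment s x o ^ 2 := by
  rw [← (Equiv.optionEquivSumPUnit.{0} A).symm.summable_iff]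
  refine Summable.sum _ ?_ ?_
  · simpa [Function.comp_def, augment] using summable_sq x
  · exact (hasSum_fintype _).summable

theorem stronglySummable_tensorOne {A : Type*} : StronglySummable (tensorOne (A := A)) := by
  intro R _
  refine summable_of_ne_finset_zero (s := {[]}) fun w hw => ?_
  have : w.length ≠ 0 := by simpa using hw
  simp [tensorOne, this]

theorem sum_prod_sq_le {A : Type*} {v : A → ℝ} (hv : Summable fun a => v a ^ 2) (n : ℕ)
    (s : Finset (Fin n → A)) : ∑ p ∈ s, ∏ i, v (p i) ^ 2 ≤ (∑' a, v a ^ 2) ^ n := by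
  classical
  let B : Finset A := s.biUnion fun p => Finset.univ.image p
  have hs : s ⊆ Fintype.piFinset fun _ : Fin n => B := by
    intro p hp
    rw [Fintype.mem_piFinset]
    intro i
    exact Finset.mem_biUnion.2 ⟨p, hp, Finset.mem_image_of_mem _ (Finset.mem_univ i)⟩
  calc ∑ p ∈ s, ∏ i, v (p i) ^ 2
      ≤ ∑ p ∈ Fintype.piFinset fun _ : Fin n => B, ∏ i, v (p i) ^ 2 :=
        Finset.sum_le_sum_of_subset_of_nonneg hs
          fun p _ _ => Finset.prod_nonneg fun i _ => sq_nonneg _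
    _ = (∑ a ∈ B, v a ^ 2) ^ n := (Finset.sum_pow' B (fun a => v a ^ 2) n).symm
    _ ≤ (∑' a, v a ^ 2) ^ n :=
        pow_le_pow_left₀ (Finset.sum_nonneg fun a _ => sq_nonneg _)
          (hv.sum_le_tsum B fun a _ => sq_nonneg _) n

theorem tensorExp_ofFn {A : Type*} (v : A → ℝ) (R : ℝ) {n : ℕ} (p : Fin n → A) :
    R ^ (List.ofFn p).length * tensorExp v (List.ofFn p) ^ 2 =
      (R ^ n / (n ! : ℝ) ^ 2) * ∏ i, v (p i) ^ 2 := by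
  have : (List.map v (List.ofFn p)).prod = ∏ i, v (p i) := by
    rw [List.map_ofFn, List.prod_ofFn]; rfl
  rw [tensorExp, this, List.length_ofFn, div_pow, ← Finset.prod_pow]
  ring

theorem summable_prod_sq {A : Type*} {v : A → ℝ} (hv : Summable fun a => v a ^ 2) (n : ℕ) :
    Summable fun p : Fin n → A => ∏ i, v (p i) ^ 2 :=
  summable_of_sum_le (fun _ => Finset.prod_nonneg fun _ _ => sq_nonneg _) (sum_prod_sq_le hv n)

theorem stronglySummable_tensorExp {A : Type*} {v : A → ℝ} (hv : Summable fun a => v a ^ 2) :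
    StronglySummable (tensorExp v) := by
  intro R hR
  have h0 : ∀ q : (n : ℕ) × (Fin n → A), 0 ≤ R ^ q.1 / (q.1 ! : ℝ) ^ 2 * ∏ i, v (q.2 i) ^ 2 :=
    fun q => mul_nonneg (by positivity) (Finset.prod_nonneg fun i _ => sq_nonneg _)
  have hsum : Summable fun q : (n : ℕ) × (Fin n → A) =>
      R ^ q.1 / (q.1 ! : ℝ) ^ 2 * ∏ i, v (q.2 i) ^ 2 := by
    rw [summable_sigma_of_nonneg h0]
    refine ⟨fun n => (summable_prod_sq hv n).mul_left (R ^ n / (n ! : ℝ) ^ 2), ?_⟩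
    refine Summable.of_nonneg_of_le (fun n => tsum_nonneg fun p => h0 ⟨n, p⟩) (fun n => ?_)
      (Real.summable_pow_div_factorial (R * ∑' a, v a ^ 2))
    dsimp only
    rw [tsum_mul_left]
    have h1 : ∑' p : Fin n → A, ∏ i, v (p i) ^ 2 ≤ (∑' a, v a ^ 2) ^ n :=
      (summable_prod_sq hv n).tsum_le_of_sum_le (sum_prod_sq_le hv n)
    have h2 : (1 : ℝ) ≤ (n ! : ℝ) := by exact_mod_cast n.factorial_pos
    have h3 : R ^ n / (n ! : ℝ) ^ 2 ≤ R ^ n / (n ! : ℝ) :=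
      div_le_div_of_nonneg_left (by positivity) (by positivity) (by nlinarith)
    calc R ^ n / (n ! : ℝ) ^ 2 * ∑' p : Fin n → A, ∏ i, v (p i) ^ 2
        ≤ R ^ n / (n ! : ℝ) * (∑' a, v a ^ 2) ^ n :=
          mul_le_mul h3 h1 (tsum_nonneg fun p => Finset.prod_nonneg fun i _ => sq_nonneg _)
            (by positivity)
      _ = (R * ∑' a, v a ^ 2) ^ n / (n ! : ℝ) := by rw [mul_pow]; ring
  refine List.equivSigmaTuple.symm.summable_iff.1 (hsum.congr fun q => ?_)
  exact (tensorExp_ofFn v R q.2).symm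

theorem StronglySummable.tensorMul {A : Type*} {f g : List A → ℝ} (hf : StronglySummable f)
    (hg : StronglySummable g) : StronglySummable (tensorMul f g) := by
  intro R hR
  have hF := hf (2 * R) (by positivity)
  have hG := hg (2 * R) (by positivity)
  have hFG := hF.mul_of_nonneg hG (fun w => by dsimp; positivity) (fun w => by dsimp; positivity)
  let e : ((w : List A) × Fin (w.length + 1)) → List A × List A :=
    fun q => (q.1.take q.2, q.1.drop q.2)
  have he : Function.Injective e := by
    rintro ⟨w, k⟩ ⟨w', k'⟩ h
    simp only [e, Prod.mk.injEq] at h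
    obtain ⟨h1, h2⟩ := h
    have hw : w = w' := by
      rw [← List.take_append_drop k w, h1, h2, List.take_append_drop]
    subst hw
    have hl := congrArg List.length h1
    simp only [List.length_take] at hl
    have : k = k' := by
      apply Fin.ext
      have := k.2
      have := k'.2
      omega
    rw [this]
  refine Summable.of_nonneg_of_le (fun w => by positivity) (fun w => ?_)
    (hFG.comp_injective he).sigma
  simp only [tsum_fintype, Function.comp, e]
  rw [Fin.sum_univ_eq_sum_range (fun k => (2 * R) ^ (w.take k).length * f (w.take k) ^ 2 *
    ((2 * R) ^ (w.drop k).length * g (w.drop k) ^ 2)) (w.length + 1)]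
  have h1 := sq_sum_le_card_mul_sum_sq (s := Finset.range (w.length + 1))
    (f := fun k => f (w.take k) * g (w.drop k))
  have h2 : ((w.length + 1 : ℕ) : ℝ) ≤ 2 ^ w.length := by
    exact_mod_cast Nat.lt_two_pow_self (n := w.length)
  rw [Finset.card_range] at h1
  calc R ^ w.length * RankTwoSignature.tensorMul f g w ^ 2
      ≤ R ^ w.length * (2 ^ w.length *
          ∑ k ∈ Finset.range (w.length + 1), (f (w.take k) * g (w.drop k)) ^ 2) := by
        refine mul_le_mul_of_nonneg_left (h1.trans ?_) (by positivity)
        exact mul_le_mul_of_nonneg_right h2 (Finset.sum_nonneg fun k _ => sq_nonneg _)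
    _ = _ := by
        rw [← mul_assoc, ← mul_pow, Finset.mul_sum]
        refine Finset.sum_congr rfl fun k _ => ?_
        have hl : (w.take k).length + (w.drop k).length = w.length := by
          rw [← List.length_append, List.take_append_drop]
        rw [← hl, pow_add]
        ring

theorem memℓp_signatureCoeff {A : Type*} {N : ℕ} (t : Fin (N + 1) → ℝ)
    (x : Fin (N + 1) → EllTwo A) : Memℓp (signatureCoeff t x) 2 := by
  have h : StronglySummable (signatureCoeff t x) := by
    have hl : ∀ l : List (List (Option A) → ℝ), (∀ f ∈ l, StronglySummable f) →
        StronglySummable (l.foldr RankTwoSignature.tensorMul tensorOne) := by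
      intro l
      induction l with
      | nil => exact fun _ => stronglySummable_tensorOne
      | cons f l ih =>
        intro hl
        exact (hl f List.mem_cons_self).tensorMul
          (ih fun g hg => hl g (List.mem_cons_of_mem _ hg))
    refine hl _ fun f hf => ?_
    obtain ⟨i, rfl⟩ := List.mem_ofFn.1 hf
    exact stronglySummable_tensorExp (summable_augment _ _)
  refine memℓp_gen ?_
  simpa using h 1 one_pos

/-- The time-augmented signature of a discrete path `x` in `ℓ²(A)` on the time grid `t`. -/
def signature {A : Type*} {N : ℕ} (t : Fin (N + 1) → ℝ) (x : Fin (N + 1) → EllTwo A) :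
    TensorHilbert (Option A) :=
  ⟨signatureCoeff t x, memℓp_signatureCoeff t x⟩

/-- Paths in `ℝ^d` on a grid with `N + 1` points. -/
abbrev PathSpace (N d : ℕ) : Type := Fin (N + 1) → EuclideanSpace ℝ (Fin d)

/-- `ℝ^d` as `ℓ²` of the `d` coordinates. -/
def toEllTwo {d : ℕ} (v : EuclideanSpace ℝ (Fin d)) : EllTwo (Fin d) :=
  ⟨fun j => v j, Memℓp.all _⟩

/-- The Hilbert space built on `ℝ ⊕ ℝ^d`. -/
abbrev HilbertOne (d : ℕ) : Type := TensorHilbert (Option (Fin d))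

/-- The Hilbert space built on `ℝ ⊕ HilbertOne d`. -/
abbrev HilbertTwo (d : ℕ) : Type := TensorHilbert (Option (List (Option (Fin d))))

/-- The time-augmented signature `S` of an `ℝ^d`-valued path. -/
def sigOne {N d : ℕ} (t : Fin (N + 1) → ℝ) (x : PathSpace N d) : HilbertOne d :=
  signature t fun i => toEllTwo (x i)

/-- The rank-2 signature `S²` of a measure-valued path: the signature of the path of expected
signatures `∫ S(x) μᵢ(dx)` (Bochner integrals). -/
def sigTwo {N d : ℕ} (t : Fin (N + 1) → ℝ) (μ : Fin (N + 1) → ProbabilityMeasure (PathSpace N d)) :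
    HilbertTwo d :=
  signature t fun i => ∫ x, sigOne t x ∂(μ i : Measure (PathSpace N d))

/-- The path `ω ↦ (X₀(ω), …, X_N(ω))` of a process. -/
def pathOf {Ω : Type*} {N d : ℕ} (X : Fin (N + 1) → Ω → EuclideanSpace ℝ (Fin d)) (ω : Ω) :
    PathSpace N d :=
  fun i => X i ω

/-- The (rank-1) prediction process: at time `i` it is the regular conditional distribution
`P[X ∈ · | ℱ i]` of the whole path, that is, the conditional distribution of `X` given the identity
map into `(Ω, ℱ i)`. -/
def prediction {Ω : Type*} {mΩ : MeasurableSpace Ω} {N d : ℕ} (P : Measure Ω)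
    [IsProbabilityMeasure P] (ℱ : Filtration (Fin (N + 1)) mΩ)
    (X : Fin (N + 1) → Ω → EuclideanSpace ℝ (Fin d)) (ω : Ω) (i : Fin (N + 1)) :
    ProbabilityMeasure (PathSpace N d) :=
  letI κ : @Kernel Ω (PathSpace N d) (ℱ i) _ :=
    @condDistrib Ω Ω (PathSpace N d) _ _ _ mΩ (ℱ i) (pathOf X) id P _
  ⟨κ ω, by
    have := @instIsMarkovKernelCondDistrib
    infer_instance⟩

/-- All the expectations in the definition of the expected signatures `E[S(X)]` and `E[S²(X̂)]`
exist as Bochner integrals. -/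
def HasExpectedSignatures {Ω : Type*} {mΩ : MeasurableSpace Ω} {N d : ℕ} (t : Fin (N + 1) → ℝ)
    (P : Measure Ω) [IsProbabilityMeasure P] (ℱ : Filtration (Fin (N + 1)) mΩ)
    (X : Fin (N + 1) → Ω → EuclideanSpace ℝ (Fin d)) : Prop :=
  Integrable (fun ω => sigOne t (pathOf X ω)) P ∧
  (∀ i, ∀ᵐ ω ∂P,
    Integrable (sigOne t) (prediction P ℱ X ω i : Measure (PathSpace N d))) ∧
  Integrable (fun ω => sigTwo t (prediction P ℱ X ω)) P

end

end RankTwoSignature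

open RankTwoSignature

/-!
Along the words `none ⋯ none (some a)` the signature of a time-augmented path is the sequence of
moments `∫ sᵏ/k! duₐ(s)` of the piecewise linear interpolation `uₐ` of its `a`-th coordinate; by a
Vandermonde argument these moments determine the path.  By the shuffle identity, the span of the
signature coefficients is an algebra, so by Stone–Weierstrass it is dense in the continuous
functions on every compact set of paths.  Hence the expected signature determines the law of a
path in a compact set, and the law depends measurably on the expected signature.  The rank-2
statement follows by applying this twice: `E[S²(X̂)]` determines the law of the path of expected
signatures `∫ S dX̂ᵢ`, which takes values in a box of `∏_w ℝ`, compact in the product topology; and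
`X̂` is a measurable function of that path.
-/

namespace RankTwoSignature

/-! ### Shuffles and characters of the shuffle algebra -/

section Shuffle

variable {B : Type*}

/-- The list of all shuffles of two words, with multiplicity. -/
def shuffle : List B → List B → List (List B)
  | [], v => [v]
  | a :: u, [] => [a :: u]
  | a :: u, b :: v =>
    (shuffle u (b :: v)).map (List.cons a) ++ (shuffle (a :: u) v).map (List.cons b)
termination_by u v => u.length + v.length

theorem perm_of_mem_shuffle {u v w : List B} (hw : w ∈ shuffle u v) : w.Perm (u ++ v) := by
  induction u, v using shuffle.induct generalizing w with
  | case1 v => simp_all [shuffle]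
  | case2 a u => simp_all [shuffle]
  | case3 a u b v ih₁ ih₂ =>
    rw [shuffle, List.mem_append, List.mem_map, List.mem_map] at hw
    rcases hw with ⟨z, hz, rfl⟩ | ⟨z, hz, rfl⟩
    · exact (ih₁ hz).cons a
    · exact ((ih₂ hz).cons b).trans List.perm_middle.symm

theorem length_shuffle (u v : List B) :
    (shuffle u v).length = (u.length + v.length).choose u.length := by
  induction u, v using shuffle.induct with
  | case1 v => simp [shuffle]
  | case2 a u => simp [shuffle]
  | case3 a u b v ih₁ ih₂ =>
    rw [shuffle, List.length_append, List.length_map, List.length_map, ih₁, ih₂]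
    simp only [List.length_cons]
    rw [show u.length + 1 + (v.length + 1) = (u.length + (v.length + 1)) + 1 by omega,
      Nat.choose_succ_succ, show u.length + 1 + v.length = u.length + (v.length + 1) by omega]

/-- The sum of the values of `f` over all shuffles of `u` and `v`, with multiplicity. -/
def shuffleSum {M : Type*} [AddCommMonoid M] (f : List B → M) (u v : List B) : M :=
  ((shuffle u v).map f).sum

section AddCommMonoid

variable {M : Type*} [AddCommMonoid M]

theorem shuffleSum_nil_left (f : List B → M) (v : List B) : shuffleSum f [] v = f v := by
  simp [shuffleSum, shuffle]

theorem shuffleSum_nil_right (f : List B → M) (u : List B) : shuffleSum f u [] = f u := by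
  cases u <;> simp [shuffleSum, shuffle]

theorem shuffleSum_cons_cons (f : List B → M) (a b : B) (u v : List B) :
    shuffleSum f (a :: u) (b :: v) =
      shuffleSum (fun w => f (a :: w)) u (b :: v) +
        shuffleSum (fun w => f (b :: w)) (a :: u) v := by
  simp [shuffleSum, shuffle, Function.comp_def]

theorem shuffleSum_add (f g : List B → M) (u v : List B) :
    shuffleSum (fun w => f w + g w) u v = shuffleSum f u v + shuffleSum g u v := by
  simp [shuffleSum, List.sum_map_add]

theorem shuffleSum_const_mul {R : Type*} [NonUnitalNonAssocSemiring R] (c : R) (f : List B → R)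
    (u v : List B) : shuffleSum (fun w => c * f w) u v = c * shuffleSum f u v := by
  simp [shuffleSum, List.sum_map_mul_left]

theorem shuffleSum_congr_of_perm {f g : List B → M} {u v : List B}
    (h : ∀ w, w.Perm (u ++ v) → f w = g w) : shuffleSum f u v = shuffleSum g u v :=
  congrArg List.sum (List.map_congr_left fun w hw => h w (perm_of_mem_shuffle hw))

theorem shuffleSum_const (c : M) (u v : List B) :
    shuffleSum (fun _ => c) u v = (u.length + v.length).choose u.length • c := by
  rw [shuffleSum, List.map_const', List.sum_replicate, length_shuffle]

theorem map_shuffleSum {M' F : Type*} [AddCommMonoid M'] [FunLike F M M'] [AddMonoidHomClass F M M']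
    (g : F) (f : List B → M) (u v : List B) :
    g (shuffleSum f u v) = shuffleSum (fun w => g (f w)) u v := by
  simp [shuffleSum, map_list_sum, Function.comp_def]

end AddCommMonoid

/-- `f` is a character of the shuffle algebra on the words in `B`: it maps the empty word to `1`
and the shuffle product to the product. -/
structure IsShuffleCharacter {R : Type*} [Semiring R] (f : List B → R) : Prop where
  map_nil : f [] = 1
  map_shuffle : ∀ u v, shuffleSum f u v = f u * f v

theorem IsShuffleCharacter.mul_mem_span (R : Type*) {A : Type*} [CommSemiring R] [Semiring A]
    [Algebra R A] {f : List B → A} (hf : IsShuffleCharacter f) {x y : A}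
    (hx : x ∈ Submodule.span R (Set.range f)) (hy : y ∈ Submodule.span R (Set.range f)) :
    x * y ∈ Submodule.span R (Set.range f) := by
  refine (?_ : Submodule.span R (Set.range f) * Submodule.span R (Set.range f) ≤ _)
    (Submodule.mul_mem_mul hx hy)
  rw [Submodule.span_mul_span, Submodule.span_le]
  rintro _ ⟨_, ⟨u, rfl⟩, _, ⟨v, rfl⟩, rfl⟩
  change f u * f v ∈ _
  rw [← hf.map_shuffle]
  refine list_sum_mem fun z hz => ?_
  obtain ⟨w, -, rfl⟩ := List.mem_map.1 hz
  exact Submodule.subset_span ⟨w, rfl⟩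

theorem isShuffleCharacter_tensorExp (x : B → ℝ) : IsShuffleCharacter (tensorExp x) where
  map_nil := by simp [tensorExp]
  map_shuffle u v := by
    have hperm : ∀ w : List B, w.Perm (u ++ v) →
        tensorExp x w = (u.map x).prod * (v.map x).prod / (u.length + v.length)! := by
      intro w hw
      rw [tensorExp, (hw.map x).prod_eq, hw.length_eq, List.map_append, List.prod_append,
        List.length_append]
    rw [shuffleSum_congr_of_perm hperm, shuffleSum_const, nsmul_eq_mul, Nat.cast_add_choose,
      tensorExp, tensorExp]
    have : ((u.length + v.length)! : ℝ) ≠ 0 := by positivity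
    field_simp

theorem isShuffleCharacter_tensorOne : IsShuffleCharacter (tensorOne (A := B)) where
  map_nil := by simp [tensorOne]
  map_shuffle u v := by
    rcases u with _ | ⟨a, u⟩
    · simp [shuffleSum_nil_left, tensorOne]
    · have hperm : ∀ w : List B, w.Perm (a :: u ++ v) → tensorOne w = 0 := fun w hw =>
        if_neg (by simp [hw.length_eq])
      rw [shuffleSum_congr_of_perm hperm, shuffleSum_const]
      simp [tensorOne]

theorem tensorMul_nil (f g : List B → ℝ) : tensorMul f g [] = f [] * g [] := by
  simp [tensorMul]

theorem tensorMul_cons (f g : List B → ℝ) (a : B) (w : List B) :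
    tensorMul f g (a :: w) = f [] * g (a :: w) + tensorMul (fun z => f (a :: z)) g w := by
  rw [tensorMul, List.length_cons, Finset.sum_range_succ', add_comm]
  simp [tensorMul]

theorem shuffleSum_tensorMul (f g : List B → ℝ) (u v : List B) :
    shuffleSum (tensorMul f g) u v =
      ∑ j ∈ Finset.range (u.length + 1), ∑ k ∈ Finset.range (v.length + 1),
        shuffleSum f (u.take j) (v.take k) * shuffleSum g (u.drop j) (v.drop k) := by
  induction u, v using shuffle.induct generalizing f g with
  | case1 v => simp [shuffleSum_nil_left, tensorMul]
  | case2 a u => simp [shuffleSum_nil_right, tensorMul]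
  | case3 a u b v ih₁ ih₂ =>
    rw [shuffleSum_cons_cons]
    simp_rw [tensorMul_cons, shuffleSum_add, shuffleSum_const_mul]
    rw [ih₁, ih₂]
    simp only [List.length_cons]
    rw [Finset.sum_range_succ' _ (u.length + 1)]
    simp_rw [Finset.sum_range_succ' _ (v.length + 1)]
    rw [Finset.sum_range_succ' _ (u.length + 1)]
    simp only [List.take_succ_cons, List.drop_succ_cons, List.take_zero, List.drop_zero,
      shuffleSum_nil_left, shuffleSum_nil_right, shuffleSum_cons_cons g, shuffleSum_cons_cons f,
      add_mul, Finset.sum_add_distrib]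
    ring

theorem IsShuffleCharacter.tensorMul {f g : List B → ℝ} (hf : IsShuffleCharacter f)
    (hg : IsShuffleCharacter g) : IsShuffleCharacter (tensorMul f g) where
  map_nil := by rw [tensorMul_nil, hf.map_nil, hg.map_nil, one_mul]
  map_shuffle u v := by
    rw [shuffleSum_tensorMul, RankTwoSignature.tensorMul, RankTwoSignature.tensorMul,
      Finset.sum_mul_sum]
    simp_rw [hf.map_shuffle, hg.map_shuffle, mul_mul_mul_comm]

end Shuffle

/-! ### Products of tensor exponentials -/

section ExpProd

variable {B : Type*} {n : ℕ}

/-- The tensor product `exp_⊗ (v 0) ⊗ ⋯ ⊗ exp_⊗ (v (n - 1))`, in this order. -/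
noncomputable def expProd (v : Fin n → B → ℝ) : List B → ℝ :=
  (List.ofFn fun i => tensorExp (v i)).foldr tensorMul tensorOne

theorem expProd_zero (v : Fin 0 → B → ℝ) : expProd v = tensorOne := by
  simp [expProd]

theorem expProd_succ (v : Fin (n + 1) → B → ℝ) :
    expProd v = tensorMul (tensorExp (v 0)) (expProd fun i => v i.succ) := by
  simp [expProd, List.ofFn_succ]

theorem isShuffleCharacter_expProd (v : Fin n → B → ℝ) : IsShuffleCharacter (expProd v) := by
  induction n with
  | zero => rw [expProd_zero]; exact isShuffleCharacter_tensorOne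
  | succ n ih => rw [expProd_succ]; exact (isShuffleCharacter_tensorExp _).tensorMul (ih _)

theorem stronglySummable_expProd {v : Fin n → B → ℝ} (hv : ∀ i, Summable fun b => v i b ^ 2) :
    StronglySummable (expProd v) := by
  induction n with
  | zero => rw [expProd_zero]; exact stronglySummable_tensorOne
  | succ n ih =>
    rw [expProd_succ]
    exact (stronglySummable_tensorExp (hv 0)).tensorMul (ih fun i => hv i.succ)

theorem abs_tensorExp_le {x m : B → ℝ} (h : ∀ b, |x b| ≤ m b) (w : List B) :
    |tensorExp x w| ≤ tensorExp m w := by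
  rw [tensorExp, tensorExp, abs_div, Nat.abs_cast]
  refine div_le_div_of_nonneg_right ?_ (by positivity)
  induction w with
  | nil => simp
  | cons b w ih =>
    simp only [List.map_cons, List.prod_cons, abs_mul]
    exact mul_le_mul (h b) ih (abs_nonneg _) ((abs_nonneg _).trans (h b))

theorem abs_expProd_le {v m : Fin n → B → ℝ} (h : ∀ i b, |v i b| ≤ m i b) (w : List B) :
    |expProd v w| ≤ expProd m w := by
  induction n generalizing w with
  | zero =>
    rw [expProd_zero, expProd_zero, tensorOne]
    split_ifs <;> simp
  | succ n ih =>
    rw [expProd_succ, expProd_succ]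
    refine (Finset.abs_sum_le_sum_abs _ _).trans (Finset.sum_le_sum fun k _ => ?_)
    rw [abs_mul]
    exact mul_le_mul (abs_tensorExp_le (h 0) _) (ih (fun i => h i.succ) _) (abs_nonneg _)
      ((abs_nonneg _).trans (abs_tensorExp_le (h 0) _))

theorem continuous_tensorExp : Continuous (tensorExp : (B → ℝ) → List B → ℝ) := by
  refine continuous_pi fun w => Continuous.div_const ?_ _
  induction w with
  | nil => exact continuous_const
  | cons b w ih =>
    simp only [List.map_cons, List.prod_cons]
    exact (continuous_apply b).mul ih

theorem continuous_expProd : Continuous (expProd : (Fin n → B → ℝ) → List B → ℝ) := by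
  induction n with
  | zero => exact continuous_const
  | succ n ih =>
    refine continuous_pi fun w => ?_
    simp_rw [expProd_succ, tensorMul]
    have hhead : Continuous fun v : Fin (n + 1) → B → ℝ => tensorExp (v 0) :=
      continuous_tensorExp.comp (continuous_apply 0)
    have htail : Continuous fun v : Fin (n + 1) → B → ℝ => expProd fun i => v i.succ :=
      ih.comp (by fun_prop)
    fun_prop

end ExpProd

/-! ### The signature along time words -/

section TimeSeries

open PowerSeries

/-- The power series of `exp (s X)`. -/
noncomputable def expSeries (s : ℝ) : PowerSeries ℝ := rescale s (exp ℝ)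

theorem coeff_expSeries (s : ℝ) (k : ℕ) : coeff k (expSeries s) = s ^ k / k ! := by
  simp [expSeries, coeff_rescale, coeff_exp, div_eq_mul_inv]

theorem expSeries_zero : expSeries 0 = 1 := by
  simp [expSeries]

theorem expSeries_mul (r s : ℝ) : expSeries r * expSeries s = expSeries (r + s) :=
  exp_mul_exp_eq_exp_add r s

/-- The power series of `(exp (s X) - 1) / (s X)`, which is `1` for `s = 0`. -/
noncomputable def expDivSeries (s : ℝ) : PowerSeries ℝ := mk fun k => s ^ k / (k + 1)!

theorem expDivSeries_zero : expDivSeries 0 = 1 := by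
  ext k
  rcases k with _ | k <;> simp [expDivSeries, coeff_one]

theorem smul_X_mul_expDivSeries (s : ℝ) : s • (X * expDivSeries s) = expSeries s - 1 := by
  ext k
  rw [coeff_smul, map_sub, coeff_expSeries, coeff_one]
  rcases k with _ | k
  · simp
  · rw [coeff_succ_X_mul, expDivSeries, coeff_mk, if_neg k.succ_ne_zero, smul_eq_mul]
    ring

theorem sub_smul_X_mul_expSeries_mul_expDivSeries (r s : ℝ) :
    (s - r) • (X * (expSeries r * expDivSeries (s - r))) = expSeries s - expSeries r := by
  rw [mul_left_comm, ← mul_smul_comm, smul_X_mul_expDivSeries, mul_sub, expSeries_mul,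
    add_sub_cancel, mul_one]

/-- The generating series `∑ₖ G(none ⋯ none (some a)) Xᵏ` of the coefficients of `G` at the words
in which `k` copies of the time letter precede the letter `a`. -/
noncomputable def timeSeries {A : Type*} (G : List (Option A) → ℝ) (a : A) : PowerSeries ℝ :=
  mk fun k => G (List.replicate k none ++ [some a])

theorem timeSeries_tensorOne {A : Type*} (a : A) : timeSeries tensorOne a = 0 := by
  ext k
  simp [timeSeries, tensorOne]

theorem timeSeries_tensorMul {A : Type*} (y : Option A → ℝ) (G : List (Option A) → ℝ) (a : A) :
    timeSeries (tensorMul (tensorExp y) G) a =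
      expSeries (y none) * timeSeries G a + (y (some a) * G []) • expDivSeries (y none) := by
  ext k
  rw [timeSeries, coeff_mk, map_add, coeff_smul, coeff_mul,
    Finset.Nat.sum_antidiagonal_eq_sum_range_succ
      (fun i j => coeff i (expSeries (y none)) * coeff j (timeSeries G a)), tensorMul]
  simp only [List.length_append, List.length_replicate, List.length_singleton]
  rw [Finset.sum_range_succ]
  congr 1
  · refine Finset.sum_congr rfl fun j hj => ?_
    have hj' : j ≤ k := Nat.lt_succ_iff.1 (Finset.mem_range.1 hj)
    rw [coeff_expSeries, timeSeries, coeff_mk, List.take_append_of_le_length (by simpa),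
      List.drop_append_of_le_length (by simpa), List.take_replicate, List.drop_replicate,
      min_eq_left hj']
    simp [tensorExp]
  · rw [List.take_of_length_le (by simp), List.drop_of_length_le (by simp), expDivSeries, coeff_mk]
    simp only [tensorExp, List.map_append, List.map_replicate, List.map_cons, List.map_nil,
      List.prod_append, List.prod_replicate, List.prod_singleton, List.length_append,
      List.length_replicate, List.length_singleton, smul_eq_mul]
    ring

theorem timeSeries_expProd {A : Type*} {n : ℕ} (s : Fin (n + 1) → ℝ) (v : Fin n → Option A → ℝ)
    (hv : ∀ i, v i none = s i.succ - s i.castSucc) (a : A) :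
    expSeries (s 0) * timeSeries (expProd v) a =
      ∑ i, v i (some a) •
        (expSeries (s i.castSucc) * expDivSeries (s i.succ - s i.castSucc)) := by
  induction n with
  | zero => simp [expProd_zero, timeSeries_tensorOne]
  | succ n ih =>
    have htail := ih (fun i => s i.succ) (fun i => v i.succ) fun i => hv i.succ
    rw [expProd_succ, timeSeries_tensorMul, hv 0, mul_add, ← mul_assoc, expSeries_mul,
      Fin.castSucc_zero, add_sub_cancel, htail, (isShuffleCharacter_expProd _).map_nil,
      Fin.sum_univ_succ, add_comm, Fin.castSucc_zero, mul_one, mul_smul_comm]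
    simp only [Fin.succ_castSucc]

variable {N : ℕ} {t : Fin (N + 1) → ℝ}

theorem eq_zero_of_smul_X_add_sum_smul_expSeries_eq_zero (ht0 : t 0 = 0) (ht : Function.Injective t)
    {e : ℝ} {w : Fin (N + 1) → ℝ} (h : e • X + ∑ l, w l • expSeries (t l) = 0) :
    e = 0 ∧ w = 0 := by
  have hcoeff : ∀ k, e * coeff k X + ∑ l, w l * (t l ^ k / k !) = 0 := fun k => by
    simpa only [map_add, map_sum, coeff_smul, coeff_expSeries, map_zero, smul_eq_mul] using
      congrArg (coeff k) h
  -- The coefficient `e` of `X` acts as an extra weight at the node `t 0 = 0`.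
  let v : Fin (N + 1) → ℝ := fun l => w l * t l + if l = 0 then e else 0
  have hpow : ∀ k : ℕ, ∑ l, v l * t l ^ k = 0 := by
    intro k
    have hfac : ((k + 1)! : ℝ) ≠ 0 := by positivity
    calc ∑ l, v l * t l ^ k
        = ∑ l, w l * t l ^ (k + 1) + e * 0 ^ k := by
          simp_rw [v, add_mul, Finset.sum_add_distrib, ite_mul, zero_mul,
            Finset.sum_ite_eq', Finset.mem_univ, if_true, ht0, pow_succ', mul_assoc]
      _ = (k + 1)! * (e * coeff (k + 1) X + ∑ l, w l * (t l ^ (k + 1) / (k + 1)!)) := by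
          rw [mul_add, Finset.mul_sum, coeff_X, add_comm]
          congr 1
          · rcases k with _ | k <;> simp
          · exact Finset.sum_congr rfl fun l _ => by field_simp
      _ = 0 := by rw [hcoeff, mul_zero]
  have hv : v = 0 := Matrix.eq_zero_of_forall_pow_sum_mul_pow_eq_zero ht fun k => hpow k
  have hne : ∀ l ≠ 0, w l = 0 := fun l hl => by
    have htl : t l ≠ 0 := fun h => hl (ht (h.trans ht0.symm))
    simpa [v, hl, htl] using congrFun hv l
  refine ⟨by simpa [v, ht0] using congrFun hv 0, funext fun l => ?_⟩
  rcases eq_or_ne l 0 with rfl | hl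
  · have hsum : ∑ l, w l = 0 := by simpa using hcoeff 0
    rwa [Finset.sum_eq_single_of_mem 0 (Finset.mem_univ 0) fun l _ => hne l] at hsum
  · exact hne l hl

/-- The generating series `∑ₖ Xᵏ ∫ sᵏ/k! du(s)` of the moments of the piecewise linear path `u`
with the values `u i` at the times `t i` and a jump from `0` to `u 0` at time `0`. -/
noncomputable def momentSeries (t u : Fin (N + 1) → ℝ) : PowerSeries ℝ :=
  C (u 0) + ∑ i : Fin N, (u i.succ - u i.castSucc) •
    (expSeries (t i.castSucc) * expDivSeries (t i.succ - t i.castSucc))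

theorem momentSeries_sub (t u v : Fin (N + 1) → ℝ) :
    momentSeries t (u - v) = momentSeries t u - momentSeries t v := by
  simp only [momentSeries, Pi.sub_apply, add_sub_add_comm, ← Finset.sum_sub_distrib, ← sub_smul,
    map_sub, sub_sub_sub_comm]

theorem X_mul_momentSeries (ht : Function.Injective t) (u : Fin (N + 1) → ℝ) :
    X * momentSeries t u = u 0 • X + ∑ i : Fin N,
      ((u i.succ - u i.castSucc) / (t i.succ - t i.castSucc)) •
        (expSeries (t i.succ) - expSeries (t i.castSucc)) := by
  rw [momentSeries, mul_add, mul_comm X, ← smul_eq_C_mul, Finset.mul_sum]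
  congr 1
  refine Finset.sum_congr rfl fun i _ => ?_
  have hi : t i.succ - t i.castSucc ≠ 0 := sub_ne_zero.2 (ht.ne i.castSucc_lt_succ.ne')
  rw [← sub_smul_X_mul_expSeries_mul_expDivSeries, smul_smul, div_mul_cancel₀ _ hi, mul_smul_comm]

theorem sum_smul_succ_sub_castSucc {R M : Type*} [Ring R] [AddCommGroup M] [Module R M]
    (b : Fin N → R) (f : Fin (N + 1) → M) :
    ∑ i : Fin N, b i • (f i.succ - f i.castSucc) =
      ∑ l, (Fin.cons 0 b - Fin.snoc b 0 : Fin (N + 1) → R) l • f l := by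
  simp only [Pi.sub_apply, sub_smul, smul_sub, Finset.sum_sub_distrib]
  rw [Fin.sum_univ_succ, Fin.sum_univ_castSucc fun l => (Fin.snoc b 0 : Fin (N + 1) → R) l • f l]
  simp

theorem eq_zero_of_cons_eq_snoc {M : Type*} [Zero M] {b : Fin N → M}
    (h : (Fin.cons 0 b : Fin (N + 1) → M) = Fin.snoc b 0) : b = 0 := by
  have hcons : ∀ l, (Fin.cons 0 b : Fin (N + 1) → M) l = 0 := by
    intro l
    induction l using Fin.induction with
    | zero => rfl
    | succ i ih => rwa [h, Fin.snoc_castSucc] at ih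
  exact funext fun i => hcons i.succ

theorem momentSeries_injective (ht0 : t 0 = 0) (ht : Function.Injective t) :
    Function.Injective (momentSeries t) := by
  intro u v huv
  rw [← sub_eq_zero, ← momentSeries_sub] at huv
  have hX := X_mul_momentSeries ht (u - v)
  rw [huv, mul_zero, sum_smul_succ_sub_castSucc (N := N) _ fun l => expSeries (t l)] at hX
  obtain ⟨hzero, hsub⟩ := eq_zero_of_smul_X_add_sum_smul_expSeries_eq_zero ht0 ht hX.symm
  have hslope := eq_zero_of_cons_eq_snoc (sub_eq_zero.1 hsub)
  have hincr : ∀ i : Fin N, (u - v) i.succ = (u - v) i.castSucc := fun i => by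
    have hi : t i.succ - t i.castSucc ≠ 0 := sub_ne_zero.2 (ht.ne i.castSucc_lt_succ.ne')
    exact sub_eq_zero.1 ((div_eq_zero_iff.1 (congrFun hslope i)).resolve_right hi)
  refine sub_eq_zero.1 (funext fun i => ?_)
  induction i using Fin.induction with
  | zero => exact hzero
  | succ i ih => exact (hincr i).trans ih

end TimeSeries

/-! ### The time-augmented signature in coordinates -/

section PathSig

variable {A : Type*} {N : ℕ}

/-- The increments of the time-augmented path with coordinates `x i a`. -/
noncomputable def pathIncrement (t : Fin (N + 1) → ℝ) (x : Fin (N + 1) → A → ℝ)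
    (i : Fin (N + 1)) : Option A → ℝ :=
  fun o => o.elim (increment t i) fun a => increment (fun j => x j a) i

/-- The coefficients of the time-augmented signature of a path with coordinates `x i a`.  Unlike in
`signature`, the values of the path need not be square-summable, so that boxes of paths are compact
in the topology of the product. -/
noncomputable def pathSig (t : Fin (N + 1) → ℝ) (x : Fin (N + 1) → A → ℝ) :
    List (Option A) → ℝ :=
  expProd (pathIncrement t x)

theorem signature_apply (t : Fin (N + 1) → ℝ) (x : Fin (N + 1) → EllTwo A)
    (w : List (Option A)) : signature t x w = pathSig t (fun i a => x i a) w := by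
  have hincr : ∀ i, augment (increment t i) (increment x i) =
      pathIncrement t (fun i a => x i a) i := by
    intro i
    funext o
    rcases o with _ | a
    · rfl
    · refine Fin.cases ?_ (fun j => ?_) i <;> rfl
  simp only [signature, signatureCoeff, hincr, pathSig, expProd]

theorem isShuffleCharacter_pathSig (t : Fin (N + 1) → ℝ) (x : Fin (N + 1) → A → ℝ) :
    IsShuffleCharacter (pathSig t x) :=
  isShuffleCharacter_expProd _

theorem continuous_pathSig (t : Fin (N + 1) → ℝ) :
    Continuous (pathSig t : (Fin (N + 1) → A → ℝ) → List (Option A) → ℝ) := by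
  refine continuous_expProd.comp (continuous_pi fun i => continuous_pi fun o => ?_)
  rcases o with _ | a
  · exact continuous_const
  · refine Fin.cases ?_ (fun j => ?_) i
    · exact (by fun_prop : Continuous fun x : Fin (N + 1) → A → ℝ => x 0 a)
    · exact (by fun_prop : Continuous fun x : Fin (N + 1) → A → ℝ => x j.succ a - x j.castSucc a)

theorem timeSeries_pathSig {t : Fin (N + 1) → ℝ} (ht0 : t 0 = 0) (x : Fin (N + 1) → A → ℝ)
    (a : A) : timeSeries (pathSig t x) a = momentSeries t fun i => x i a := by
  have h := timeSeries_expProd (Fin.cons 0 t : Fin (N + 2) → ℝ) (pathIncrement t x)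
    (fun i => by refine Fin.cases ?_ (fun j => ?_) i <;> simp [pathIncrement, increment]) a
  rw [Fin.cons_zero, expSeries_zero, one_mul, Fin.sum_univ_succ] at h
  simpa [pathSig, pathIncrement, increment, ht0, expSeries_zero, expDivSeries_zero, momentSeries,
    PowerSeries.smul_eq_C_mul] using h

theorem pathSig_injective {t : Fin (N + 1) → ℝ} (ht0 : t 0 = 0) (ht : Function.Injective t) :
    Function.Injective (pathSig t : (Fin (N + 1) → A → ℝ) → List (Option A) → ℝ) := by
  intro x y h
  funext i a
  have hmom : momentSeries t (fun i => x i a) = momentSeries t fun i => y i a := by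
    rw [← timeSeries_pathSig ht0, ← timeSeries_pathSig ht0, h]
  exact congrFun (momentSeries_injective ht0 ht hmom) i

end PathSig

/-! ### Measures on compact sets and dense families of continuous functions -/

section DenseSpan

variable {Z : Type*} [TopologicalSpace Z] [CompactSpace Z] [MeasurableSpace Z] [BorelSpace Z]

/-- Integration against a finite measure as a continuous linear functional on `C(Z, ℝ)`. -/
noncomputable def integralContinuousMap (μ : Measure Z) [IsFiniteMeasure μ] : C(Z, ℝ) →L[ℝ] ℝ :=
  LinearMap.mkContinuous
    { toFun := fun f => ∫ z, f z ∂μ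
      map_add' := fun f g => integral_add
        (f.continuous.integrable_of_hasCompactSupport (.of_compactSpace f))
        (g.continuous.integrable_of_hasCompactSupport (.of_compactSpace g))
      map_smul' := fun c f => integral_smul c f }
    (μ.real Set.univ) fun f => (norm_integral_le_of_norm_le_const
      (ae_of_all μ f.norm_coe_le_norm)).trans_eq (mul_comm _ _)

theorem integralContinuousMap_apply (μ : Measure Z) [IsFiniteMeasure μ] (f : C(Z, ℝ)) :
    integralContinuousMap μ f = ∫ z, f z ∂μ :=
  rfl

variable {S : Set C(Z, ℝ)}

theorem eq_of_forall_integral_eq_of_dense_span [HasOuterApproxClosed Z] {μ ν : Measure Z}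
    [IsFiniteMeasure μ] [IsFiniteMeasure ν]
    (hS : Dense (Submodule.span ℝ S : Set C(Z, ℝ)))
    (h : ∀ f ∈ S, ∫ z, f z ∂μ = ∫ z, f z ∂ν) : μ = ν := by
  have hμν : integralContinuousMap μ = integralContinuousMap ν := ContinuousLinearMap.ext_on hS h
  exact ext_of_forall_integral_eq_of_IsFiniteMeasure fun f =>
    DFunLike.congr_fun hμν f.toContinuousMap

variable {α : Type*} [MeasurableSpace α] {κ : α → Measure Z}

theorem measurable_integral_of_dense_span [∀ a, IsFiniteMeasure (κ a)]
    (hS : Dense (Submodule.span ℝ S : Set C(Z, ℝ)))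
    (h : ∀ f ∈ S, Measurable fun a => ∫ z, f z ∂κ a) (f : C(Z, ℝ)) :
    Measurable fun a => ∫ z, f z ∂κ a := by
  simp only [← integralContinuousMap_apply] at h ⊢
  have hspan : ∀ g ∈ Submodule.span ℝ S, Measurable fun a => integralContinuousMap (κ a) g := by
    intro g hg
    induction hg using Submodule.span_induction with
    | mem g hg => exact h g hg
    | zero => simp
    | add g₁ g₂ _ _ h₁ h₂ => simpa only [map_add] using h₁.fun_add h₂
    | smul c g _ hg => simpa using hg.const_mul c
  obtain ⟨u, hu, hlim⟩ := mem_closure_iff_seq_limit.1 (hS f)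
  exact measurable_of_tendsto_metrizable (fun n => hspan _ (hu n)) <| tendsto_pi_nhds.2 fun a =>
    ((integralContinuousMap (κ a)).continuous.tendsto f).comp hlim

theorem measurable_measure_of_dense_span [HasOuterApproxClosed Z]
    [∀ a, IsProbabilityMeasure (κ a)] (hS : Dense (Submodule.span ℝ S : Set C(Z, ℝ)))
    (h : ∀ f ∈ S, Measurable fun a => ∫ z, f z ∂κ a) : Measurable κ := by
  refine Measurable.measure_of_isPiSystem_of_isProbabilityMeasure
    ((BorelSpace.measurable_eq (α := Z)).trans borel_eq_generateFrom_isClosed)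
    isPiSystem_isClosed fun F hF => ?_
  refine measurable_of_tendsto_metrizable (fun n => ?_)
    (tendsto_pi_nhds.2 fun a => HasOuterApproxClosed.tendsto_lintegral_apprSeq hF (κ a))
  let g : C(Z, ℝ) := ⟨fun z => hF.apprSeq n z, by fun_prop⟩
  have hg : ∀ a, ∫⁻ z, hF.apprSeq n z ∂κ a = ENNReal.ofReal (∫ z, g z ∂κ a) := fun a =>
    lintegral_coe_eq_integral _ (g.continuous.integrable_of_hasCompactSupport (.of_compactSpace g))
  simp_rw [hg]
  exact (measurable_integral_of_dense_span hS h g).ennreal_ofReal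

end DenseSpan

section ConcentratedMeasures

variable {E : Type*} [MeasurableSpace E] {s : Set E} {μ ν : Measure E}

theorem map_comap_subtype_coe_of_ae_mem (hs : MeasurableSet s) (hμ : ∀ᵐ x ∂μ, x ∈ s) :
    (μ.comap ((↑) : s → E)).map (↑) = μ := by
  rw [map_comap_subtype_coe hs, Measure.restrict_eq_self_of_ae_mem hμ]

theorem integral_comap_subtype_coe_of_ae_mem (hs : MeasurableSet s) (hμ : ∀ᵐ x ∂μ, x ∈ s)
    (f : E → ℝ) : ∫ z : s, f z ∂μ.comap (↑) = ∫ x, f x ∂μ := by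
  rw [integral_subtype_comap hs, Measure.restrict_eq_self_of_ae_mem hμ]

theorem isProbabilityMeasure_comap_subtype_coe_of_ae_mem [IsProbabilityMeasure μ]
    (hs : MeasurableSet s) (hμ : ∀ᵐ x ∂μ, x ∈ s) :
    IsProbabilityMeasure (μ.comap ((↑) : s → E)) :=
  isProbabilityMeasure_comap Subtype.val_injective (by simpa using hμ)
    fun _ => hs.subtype_image

theorem eq_of_map_eq_of_measurable_comap {E' : Type*} [MeasurableSpace E'] {F : E → E'}
    (hF : Measurable F)
    (hgen : Measurable[MeasurableSpace.comap (s.domRestrict F) inferInstance] ((↑) : s → E))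
    (hμ : ∀ᵐ x ∂μ, x ∈ s) (hν : ∀ᵐ x ∂ν, x ∈ s) (h : μ.map F = ν.map F) : μ = ν := by
  ext U hU
  obtain ⟨V, hV, hVU⟩ := hgen hU
  have hmem : ∀ x ∈ s, x ∈ F ⁻¹' V ↔ x ∈ U := fun x hx => Set.ext_iff.1 hVU ⟨x, hx⟩
  calc μ U = μ (F ⁻¹' V) :=
        measure_congr (hμ.mono fun x hx => propext (hmem x hx).symm)
    _ = ν (F ⁻¹' V) := by rw [← Measure.map_apply hF hV, h, Measure.map_apply hF hV]
    _ = ν U := measure_congr (hν.mono fun x hx => propext (hmem x hx))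

end ConcentratedMeasures

/-! ### Families of shuffle characters on a compact set -/

section CharacterFamily

variable {B : Type*}

theorem isShuffleCharacter_continuousMap {Z : Type*} [TopologicalSpace Z] {f : List B → C(Z, ℝ)}
    (hf : ∀ z, IsShuffleCharacter fun w => f w z) : IsShuffleCharacter f where
  map_nil := ContinuousMap.ext fun z => (hf z).map_nil
  map_shuffle u v := ContinuousMap.ext fun z =>
    (map_shuffleSum (ContinuousMap.evalCLM ℝ z) f u v).trans ((hf z).map_shuffle u v)

theorem IsShuffleCharacter.dense_span_range {Z : Type*} [TopologicalSpace Z] [CompactSpace Z]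
    {f : List B → C(Z, ℝ)} (hf : IsShuffleCharacter f)
    (hsep : ∀ y z, (∀ w, f w y = f w z) → y = z) :
    Dense (Submodule.span ℝ (Set.range f) : Set C(Z, ℝ)) := by
  have hone : (1 : C(Z, ℝ)) ∈ Submodule.span ℝ (Set.range f) :=
    Submodule.subset_span ⟨[], hf.map_nil⟩
  let 𝒜 := (Submodule.span ℝ (Set.range f)).toSubalgebra hone fun _ _ => hf.mul_mem_span ℝ
  have h𝒜 : 𝒜.SeparatesPoints := by
    intro y z hyz
    obtain ⟨w, hw⟩ := not_forall.1 (mt (hsep y z) hyz)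
    exact ⟨f w, ⟨f w, Submodule.subset_span ⟨w, rfl⟩, rfl⟩, hw⟩
  intro g
  have hg : g ∈ 𝒜.topologicalClosure :=
    ContinuousMap.subalgebra_topologicalClosure_eq_top_of_separatesPoints 𝒜 h𝒜 ▸ Algebra.mem_top
  exact hg

variable {E : Type*} [TopologicalSpace E] {s : Set E} {f : E → List B → ℝ}

/-- The function `x ↦ f x w`, restricted to `s`. -/
def coeffRestrict (hcont : ContinuousOn f s) (w : List B) : C(s, ℝ) :=
  ⟨s.domRestrict fun x => f x w, (continuousOn_pi.1 hcont w).domRestrict⟩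

theorem dense_span_range_coeffRestrict (hs : IsCompact s)
    (hchar : ∀ x ∈ s, IsShuffleCharacter (f x)) (hcont : ContinuousOn f s) (hinj : s.InjOn f) :
    Dense (Submodule.span ℝ (Set.range (coeffRestrict hcont)) : Set C(s, ℝ)) := by
  have := isCompact_iff_compactSpace.1 hs
  have hf : IsShuffleCharacter (coeffRestrict hcont) :=
    isShuffleCharacter_continuousMap fun z => hchar z z.2
  exact hf.dense_span_range fun y z h => Subtype.ext (hinj y.2 z.2 (funext h))

variable [TopologicalSpace.MetrizableSpace E] [MeasurableSpace E] [BorelSpace E]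

theorem eq_of_forall_integral_shuffleCharacter_eq (hs : IsCompact s)
    (hchar : ∀ x ∈ s, IsShuffleCharacter (f x)) (hcont : ContinuousOn f s) (hinj : s.InjOn f)
    {μ ν : Measure E} [IsFiniteMeasure μ] [IsFiniteMeasure ν] (hμ : ∀ᵐ x ∂μ, x ∈ s)
    (hν : ∀ᵐ x ∂ν, x ∈ s) (h : ∀ w, ∫ x, f x w ∂μ = ∫ x, f x w ∂ν) : μ = ν := by
  have := isCompact_iff_compactSpace.1 hs
  have hcomap : μ.comap ((↑) : s → E) = ν.comap (↑) := by
    refine eq_of_forall_integral_eq_of_dense_span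
      (dense_span_range_coeffRestrict hs hchar hcont hinj) ?_
    rintro _ ⟨w, rfl⟩
    exact (integral_comap_subtype_coe_of_ae_mem hs.measurableSet hμ fun x => f x w).trans <|
      (h w).trans (integral_comap_subtype_coe_of_ae_mem hs.measurableSet hν fun x => f x w).symm
  rw [← map_comap_subtype_coe_of_ae_mem hs.measurableSet hμ, hcomap,
    map_comap_subtype_coe_of_ae_mem hs.measurableSet hν]

theorem measurable_of_measurable_integral_shuffleCharacter (hs : IsCompact s)
    (hchar : ∀ x ∈ s, IsShuffleCharacter (f x)) (hcont : ContinuousOn f s) (hinj : s.InjOn f)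
    {α : Type*} [MeasurableSpace α] {κ : α → Measure E} [∀ a, IsProbabilityMeasure (κ a)]
    (hκ : ∀ a, ∀ᵐ x ∂κ a, x ∈ s) (h : ∀ w, Measurable fun a => ∫ x, f x w ∂κ a) :
    Measurable κ := by
  have := isCompact_iff_compactSpace.1 hs
  have hprob : ∀ a, IsProbabilityMeasure ((κ a).comap ((↑) : s → E)) := fun a =>
    isProbabilityMeasure_comap_subtype_coe_of_ae_mem hs.measurableSet (hκ a)
  have hcomap : Measurable fun a => (κ a).comap ((↑) : s → E) := by
    refine measurable_measure_of_dense_span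
      (dense_span_range_coeffRestrict hs hchar hcont hinj) ?_
    rintro _ ⟨w, rfl⟩
    convert h w using 2 with a
    exact integral_comap_subtype_coe_of_ae_mem hs.measurableSet (hκ a) fun x => f x w
  convert (Measure.measurable_map ((↑) : s → E) measurable_subtype_coe).comp hcomap using 1
  exact funext fun a => (map_comap_subtype_coe_of_ae_mem hs.measurableSet (hκ a)).symm

end CharacterFamily

/-! ### Square-summable bounds and integrability -/

section EllTwo

variable {A : Type*}

theorem norm_le_of_forall_abs_apply_le {f D : EllTwo A} (h : ∀ a, |f a| ≤ D a) : ‖f‖ ≤ ‖D‖ :=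
  lp.norm_mono (by norm_num) fun a => (h a).trans (le_abs_self _)

theorem continuous_ellTwo_apply (a : A) : Continuous fun f : EllTwo A => f a :=
  (lp.evalCLM ℝ (fun _ : A => ℝ) 2 a).continuous

theorem integral_ellTwo_apply {Ω : Type*} [MeasurableSpace Ω] {μ : Measure Ω}
    {f : Ω → EllTwo A} (hf : Integrable f μ) (a : A) : (∫ ω, f ω ∂μ) a = ∫ ω, f ω a ∂μ :=
  ((lp.evalCLM ℝ (fun _ : A => ℝ) 2 a).integral_comp_comm hf).symm

theorem stronglyMeasurable_ellTwo_of_apply [Countable A] {Ω : Type*} [MeasurableSpace Ω]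
    {f : Ω → EllTwo A} (hf : ∀ a, Measurable fun ω => f ω a) : StronglyMeasurable f := by
  classical
  refine stronglyMeasurable_of_tendsto (ι := Finset A) (u := Filter.atTop)
    (f := fun s ω => ∑ a ∈ s, lp.single 2 a (f ω a)) (fun s => ?_) ?_
  · refine Finset.stronglyMeasurable_fun_sum _ fun a _ => ?_
    exact (lp.isometry_single a).continuous.comp_stronglyMeasurable (hf a).stronglyMeasurable
  · exact tendsto_pi_nhds.2 fun ω => lp.hasSum_single (by norm_num) (f ω)

variable {N : ℕ}

theorem abs_increment_le {x : Fin (N + 1) → ℝ} {c : ℝ} (h : ∀ i, |x i| ≤ c) (i : Fin (N + 1)) :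
    |increment x i| ≤ 2 * c := by
  refine Fin.cases ?_ (fun j => ?_) i
  · change |x 0| ≤ 2 * c
    linarith [h 0, abs_nonneg (x 0)]
  · change |x j.succ - x j.castSucc| ≤ 2 * c
    linarith [abs_sub (x j.succ) (x j.castSucc), h j.succ, h j.castSucc]

theorem exists_forall_abs_pathSig_le (t : Fin (N + 1) → ℝ) (c : EllTwo A) :
    ∃ D : TensorHilbert (Option A), ∀ x : Fin (N + 1) → A → ℝ, (∀ i a, |x i a| ≤ c a) →
      ∀ w, |pathSig t x w| ≤ D w := by
  let m : Option A → ℝ := augment (∑ i, |increment t i|) ((2 : ℝ) • c)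
  have hD : Memℓp (expProd fun _ : Fin (N + 1) => m) 2 := by
    refine memℓp_gen ?_
    simpa using stronglySummable_expProd (v := fun _ : Fin (N + 1) => m)
      (fun _ => summable_augment _ _) 1 one_pos
  refine ⟨⟨_, hD⟩, fun x hx w => abs_expProd_le (fun i o => ?_) w⟩
  rcases o with _ | a
  · exact Finset.single_le_sum (f := fun j => |increment t j|) (fun _ _ => abs_nonneg _)
      (Finset.mem_univ i)
  · exact abs_increment_le (fun j => hx j a) i

end EllTwo

/-! ### Expected signatures -/

section ExpectedSignature

variable {N d : ℕ}

theorem sigOne_apply (t : Fin (N + 1) → ℝ) (x : PathSpace N d) (w : List (Option (Fin d))) :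
    sigOne t x w = pathSig t (fun i j => x i j) w :=
  signature_apply _ _ _

theorem coe_sigOne (t : Fin (N + 1) → ℝ) (x : PathSpace N d) :
    ⇑(sigOne t x) = pathSig t fun i j => x i j :=
  funext (sigOne_apply t x)

theorem isShuffleCharacter_sigOne (t : Fin (N + 1) → ℝ) (x : PathSpace N d) :
    IsShuffleCharacter (sigOne t x) :=
  coe_sigOne t x ▸ isShuffleCharacter_pathSig _ _

theorem continuous_coe_sigOne (t : Fin (N + 1) → ℝ) :
    Continuous fun x : PathSpace N d => ⇑(sigOne t x) := by
  simp_rw [coe_sigOne]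
  exact (continuous_pathSig t).comp (by fun_prop)

theorem coe_sigOne_injective {t : Fin (N + 1) → ℝ} (ht0 : t 0 = 0) (ht : Function.Injective t) :
    Function.Injective fun x : PathSpace N d => ⇑(sigOne t x) := by
  intro x y h
  simp only [coe_sigOne] at h
  have hxy := pathSig_injective ht0 ht h
  exact funext fun i => PiLp.ext fun j => congrFun (congrFun hxy i) j

theorem stronglyMeasurable_sigOne (t : Fin (N + 1) → ℝ) :
    StronglyMeasurable (sigOne (d := d) t) :=
  stronglyMeasurable_ellTwo_of_apply fun w =>
    ((continuous_apply w).comp (continuous_coe_sigOne t)).measurable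

variable {s : Set (PathSpace N d)}

theorem exists_forall_abs_sigOne_le (t : Fin (N + 1) → ℝ) (hs : Bornology.IsBounded s) :
    ∃ D : HilbertOne d, ∀ x ∈ s, ∀ w, |sigOne t x w| ≤ D w := by
  obtain ⟨C, hC⟩ := hs.exists_norm_le
  obtain ⟨D, hD⟩ := exists_forall_abs_pathSig_le t (⟨fun _ => C, Memℓp.all _⟩ : EllTwo (Fin d))
  refine ⟨D, fun x hx w => sigOne_apply t x w ▸ hD _ (fun i j => ?_) w⟩
  exact (PiLp.norm_apply_le (x i) j).trans ((norm_le_pi_norm x i).trans (hC x hx))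

theorem integrable_sigOne (t : Fin (N + 1) → ℝ) (hs : Bornology.IsBounded s)
    {μ : Measure (PathSpace N d)} [IsFiniteMeasure μ] (hμ : ∀ᵐ x ∂μ, x ∈ s) :
    Integrable (sigOne t) μ := by
  obtain ⟨D, hD⟩ := exists_forall_abs_sigOne_le t hs
  refine .of_bound (stronglyMeasurable_sigOne t).aestronglyMeasurable ‖D‖ ?_
  exact hμ.mono fun x hx => norm_le_of_forall_abs_apply_le (hD x hx)

theorem eq_iff_integral_sigOne_eq {t : Fin (N + 1) → ℝ} (ht0 : t 0 = 0)
    (ht : Function.Injective t) (hs : IsCompact s) {μ ν : Measure (PathSpace N d)}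
    [IsFiniteMeasure μ] [IsFiniteMeasure ν] (hμ : ∀ᵐ x ∂μ, x ∈ s) (hν : ∀ᵐ x ∂ν, x ∈ s) :
    μ = ν ↔ ∫ x, sigOne t x ∂μ = ∫ x, sigOne t x ∂ν := by
  refine ⟨fun h => h ▸ rfl, fun h => ?_⟩
  refine eq_of_forall_integral_shuffleCharacter_eq hs (fun x _ => isShuffleCharacter_sigOne t x)
    (continuous_coe_sigOne t).continuousOn (coe_sigOne_injective ht0 ht).injOn hμ hν fun w => ?_
  rw [← integral_ellTwo_apply (integrable_sigOne t hs.isBounded hμ), h,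
    integral_ellTwo_apply (integrable_sigOne t hs.isBounded hν)]

/-- The coefficients of the expected signatures `∫ S(x) μᵢ(dx)` along a path of measures `μ`, as a
point of a product of copies of `ℝ`. -/
noncomputable def expectedSigCoord (t : Fin (N + 1) → ℝ)
    (μ : Fin (N + 1) → ProbabilityMeasure (PathSpace N d)) (i : Fin (N + 1))
    (w : List (Option (Fin d))) : ℝ :=
  (∫ x, sigOne t x ∂(μ i : Measure (PathSpace N d))) w

theorem measurable_expectedSigCoord (t : Fin (N + 1) → ℝ) :
    Measurable (expectedSigCoord (d := d) t) := by
  refine measurable_pi_lambda _ fun i => measurable_pi_lambda _ fun w => ?_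
  let κ : Kernel (ProbabilityMeasure (PathSpace N d)) (PathSpace N d) :=
    ⟨Subtype.val, measurable_subtype_coe⟩
  have hint : StronglyMeasurable fun μ => ∫ x, sigOne t x ∂κ μ :=
    (stronglyMeasurable_sigOne t).integral_kernel
  exact ((continuous_ellTwo_apply w).comp_stronglyMeasurable hint).measurable.comp
    (measurable_pi_apply i)

theorem sigTwo_apply (t : Fin (N + 1) → ℝ)
    (μ : Fin (N + 1) → ProbabilityMeasure (PathSpace N d))
    (w : List (Option (List (Option (Fin d))))) :
    sigTwo t μ w = pathSig t (expectedSigCoord t μ) w :=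
  signature_apply _ _ _

theorem stronglyMeasurable_sigTwo (t : Fin (N + 1) → ℝ) :
    StronglyMeasurable (sigTwo (d := d) t) := by
  refine stronglyMeasurable_ellTwo_of_apply fun w => ?_
  simp_rw [sigTwo_apply]
  exact ((continuous_apply w).comp (continuous_pathSig t)).measurable.comp
    (measurable_expectedSigCoord t)

/-- The paths of probability measures all of which are concentrated on `s`. -/
def concentratedOn (s : Set (PathSpace N d)) :
    Set (Fin (N + 1) → ProbabilityMeasure (PathSpace N d)) :=
  {μ | ∀ i, ∀ᵐ x ∂(μ i : Measure (PathSpace N d)), x ∈ s}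

theorem measurableSet_concentratedOn (hs : MeasurableSet s) :
    MeasurableSet (concentratedOn s) := by
  rw [concentratedOn, Set.ofPred_forall]
  refine .iInter fun i => ?_
  have hval : Measurable fun μ : Fin (N + 1) → ProbabilityMeasure (PathSpace N d) =>
      (μ i : Measure (PathSpace N d)) sᶜ :=
    (Measure.measurable_coe hs.compl).comp (measurable_subtype_coe.comp (measurable_pi_apply i))
  exact hval (measurableSet_singleton 0)

theorem exists_forall_abs_expectedSigCoord_le (t : Fin (N + 1) → ℝ)
    (hs : Bornology.IsBounded s) :
    ∃ D : HilbertOne d, ∀ μ ∈ concentratedOn s, ∀ i w, |expectedSigCoord t μ i w| ≤ D w := by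
  obtain ⟨D, hD⟩ := exists_forall_abs_sigOne_le t hs
  refine ⟨D, fun μ hμ i w => ?_⟩
  rw [expectedSigCoord, integral_ellTwo_apply (integrable_sigOne t hs (hμ i))]
  have hbound : ∀ᵐ x ∂(μ i : Measure (PathSpace N d)), ‖sigOne t x w‖ ≤ D w :=
    (hμ i).mono fun x hx => hD x hx w
  simpa using norm_integral_le_of_norm_le_const hbound

theorem exists_forall_norm_sigTwo_le (t : Fin (N + 1) → ℝ) (hs : Bornology.IsBounded s) :
    ∃ C : ℝ, ∀ μ ∈ concentratedOn s, ‖sigTwo t μ‖ ≤ C := by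
  obtain ⟨D, hD⟩ := exists_forall_abs_expectedSigCoord_le t hs
  obtain ⟨D', hD'⟩ := exists_forall_abs_pathSig_le (N := N) t D
  refine ⟨‖D'‖, fun μ hμ => norm_le_of_forall_abs_apply_le fun w => ?_⟩
  exact sigTwo_apply t μ w ▸ hD' _ (hD μ hμ) w

theorem integrable_sigTwo (t : Fin (N + 1) → ℝ) (hs : Bornology.IsBounded s)
    {ρ : Measure (Fin (N + 1) → ProbabilityMeasure (PathSpace N d))} [IsFiniteMeasure ρ]
    (hρ : ∀ᵐ μ ∂ρ, μ ∈ concentratedOn s) : Integrable (sigTwo t) ρ := by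
  obtain ⟨C, hC⟩ := exists_forall_norm_sigTwo_le t hs
  exact .of_bound (stronglyMeasurable_sigTwo t).aestronglyMeasurable C (hρ.mono hC)

theorem measurable_coe_comap_expectedSigCoord {t : Fin (N + 1) → ℝ} (ht0 : t 0 = 0)
    (ht : Function.Injective t) (hs : IsCompact s) :
    Measurable[MeasurableSpace.comap ((concentratedOn s).domRestrict (expectedSigCoord t))
      inferInstance]
      ((↑) : concentratedOn s → Fin (N + 1) → ProbabilityMeasure (PathSpace N d)) := by
  let m : MeasurableSpace (concentratedOn s) :=
    .comap ((concentratedOn s).domRestrict (expectedSigCoord t)) inferInstance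
  have hF : Measurable[m] ((concentratedOn s).domRestrict (expectedSigCoord t)) :=
    comap_measurable _
  refine measurable_pi_lambda _ fun i => Measurable.subtype_mk ?_
  have hprob : ∀ μ : concentratedOn s, IsProbabilityMeasure (μ.1 i).1 :=
    fun μ => (μ.1 i).2
  refine measurable_of_measurable_integral_shuffleCharacter hs
    (fun x _ => isShuffleCharacter_sigOne t x) (continuous_coe_sigOne t).continuousOn
    (coe_sigOne_injective ht0 ht).injOn (fun μ => μ.2 i) fun w => ?_
  have hint : (fun μ : concentratedOn s => expectedSigCoord t μ i w) =
      fun μ => ∫ x, sigOne t x w ∂(μ.1 i).1 :=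
    funext fun μ => integral_ellTwo_apply (integrable_sigOne t hs.isBounded (μ.2 i)) w
  exact hint ▸ (measurable_pi_apply w).comp ((measurable_pi_apply i).comp hF)

theorem integral_pathSig_map_expectedSigCoord {t : Fin (N + 1) → ℝ}
    {ρ : Measure (Fin (N + 1) → ProbabilityMeasure (PathSpace N d))}
    (hρ : Integrable (sigTwo t) ρ) (w : List (Option (List (Option (Fin d))))) :
    ∫ x, pathSig t x w ∂ρ.map (expectedSigCoord t) = (∫ μ, sigTwo t μ ∂ρ) w := by
  have hsig : Continuous fun x => pathSig t x w :=
    (continuous_apply w).comp (continuous_pathSig t)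
  rw [integral_map (measurable_expectedSigCoord t).aemeasurable
    hsig.measurable.aestronglyMeasurable, integral_ellTwo_apply hρ]
  simp_rw [sigTwo_apply]

theorem map_expectedSigCoord_eq_of_integral_sigTwo_eq {t : Fin (N + 1) → ℝ} (ht0 : t 0 = 0)
    (ht : Function.Injective t) (hs : Bornology.IsBounded s)
    {ρ σ : Measure (Fin (N + 1) → ProbabilityMeasure (PathSpace N d))} [IsFiniteMeasure ρ]
    [IsFiniteMeasure σ] (hρ : ∀ᵐ μ ∂ρ, μ ∈ concentratedOn s)
    (hσ : ∀ᵐ μ ∂σ, μ ∈ concentratedOn s) (h : ∫ μ, sigTwo t μ ∂ρ = ∫ μ, sigTwo t μ ∂σ) :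
    ρ.map (expectedSigCoord t) = σ.map (expectedSigCoord t) := by
  obtain ⟨D, hD⟩ := exists_forall_abs_expectedSigCoord_le t hs
  have hF := measurable_expectedSigCoord (N := N) (d := d) t
  let box : Set (Fin (N + 1) → List (Option (Fin d)) → ℝ) := Set.Icc (fun _ w => -D w) fun _ => D
  have hbox : ∀ μ ∈ concentratedOn s, expectedSigCoord t μ ∈ box := fun μ hμ =>
    ⟨fun i w => (abs_le.1 (hD μ hμ i w)).1, fun i w => (abs_le.1 (hD μ hμ i w)).2⟩
  refine eq_of_forall_integral_shuffleCharacter_eq (s := box) isCompact_Icc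
    (fun x _ => isShuffleCharacter_pathSig t x) (continuous_pathSig t).continuousOn
    (pathSig_injective ht0 ht).injOn ?_ ?_ fun w => ?_
  · exact (ae_map_iff hF.aemeasurable measurableSet_Icc).2 (hρ.mono hbox)
  · exact (ae_map_iff hF.aemeasurable measurableSet_Icc).2 (hσ.mono hbox)
  · rw [integral_pathSig_map_expectedSigCoord (integrable_sigTwo t hs hρ),
      integral_pathSig_map_expectedSigCoord (integrable_sigTwo t hs hσ), h]

theorem eq_iff_integral_sigTwo_eq {t : Fin (N + 1) → ℝ} (ht0 : t 0 = 0)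
    (ht : Function.Injective t) (hs : IsCompact s)
    {ρ σ : Measure (Fin (N + 1) → ProbabilityMeasure (PathSpace N d))} [IsFiniteMeasure ρ]
    [IsFiniteMeasure σ] (hρ : ∀ᵐ μ ∂ρ, μ ∈ concentratedOn s)
    (hσ : ∀ᵐ μ ∂σ, μ ∈ concentratedOn s) :
    ρ = σ ↔ ∫ μ, sigTwo t μ ∂ρ = ∫ μ, sigTwo t μ ∂σ :=
  ⟨fun h => h ▸ rfl, fun h => eq_of_map_eq_of_measurable_comap (measurable_expectedSigCoord t)
    (measurable_coe_comap_expectedSigCoord ht0 ht hs) hρ hσ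
    (map_expectedSigCoord_eq_of_integral_sigTwo_eq ht0 ht hs.isBounded hρ hσ h)⟩

end ExpectedSignature

/-! ### Prediction processes -/

section Prediction

theorem ae_ae_condDistrib_mem {α β T : Type*} [MeasurableSpace α] [MeasurableSpace β]
    [MeasurableSpace T] [StandardBorelSpace T] [Nonempty T] {μ : Measure α} [IsFiniteMeasure μ]
    {X : α → β} {Y : α → T} (hX : AEMeasurable X μ) (hY : AEMeasurable Y μ) {B : Set T}
    (hB : MeasurableSet B) (h : ∀ᵐ a ∂μ, Y a ∈ B) :
    ∀ᵐ a ∂μ, ∀ᵐ y ∂condDistrib Y X μ (X a), y ∈ B := by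
  refine ae_of_ae_map hX (p := fun b => ∀ᵐ y ∂condDistrib Y X μ b, y ∈ B) ?_
  refine Measure.ae_ae_of_ae_compProd (p := fun z : β × T => z.2 ∈ B) ?_
  rw [compProd_map_condDistrib hY]
  exact (ae_map_iff (hX.prodMk hY) (measurable_snd hB)).2 h

variable {N d : ℕ} {Ω : Type*} {mΩ : MeasurableSpace Ω} {P : Measure Ω} [IsProbabilityMeasure P]
  {ℱ : Filtration (Fin (N + 1)) mΩ} {X : Fin (N + 1) → Ω → EuclideanSpace ℝ (Fin d)}

theorem measurable_prediction : Measurable (prediction P ℱ X) := by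
  refine measurable_pi_lambda _ fun i => Measurable.subtype_mk ?_
  exact Measurable.mono (@Kernel.measurable Ω (PathSpace N d) (ℱ i) _
    (@condDistrib Ω Ω (PathSpace N d) _ _ _ mΩ (ℱ i) (pathOf X) id P _)) (ℱ.le i) le_rfl

variable {s : Set (PathSpace N d)}

theorem ae_prediction_mem_concentratedOn (hX : AEMeasurable (pathOf X) P) (hs : MeasurableSet s)
    (h : ∀ᵐ ω ∂P, pathOf X ω ∈ s) : ∀ᵐ ω ∂P, prediction P ℱ X ω ∈ concentratedOn s := by
  refine ae_all_iff.2 fun i => ?_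
  have hid : @Measurable Ω Ω mΩ (ℱ i) id := measurable_id.mono le_rfl (ℱ.le i)
  exact @ae_ae_condDistrib_mem Ω Ω (PathSpace N d) mΩ (ℱ i) _ _ _ P _ id (pathOf X)
    (@Measurable.aemeasurable Ω Ω mΩ (ℱ i) id P hid) hX _ hs h

theorem ae_map_prediction_mem_concentratedOn (hX : AEMeasurable (pathOf X) P)
    (hs : MeasurableSet s) (h : ∀ᵐ ω ∂P, pathOf X ω ∈ s) :
    ∀ᵐ μ ∂P.map (prediction P ℱ X), μ ∈ concentratedOn s :=
  (ae_map_iff measurable_prediction.aemeasurable (measurableSet_concentratedOn hs)).2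
    (ae_prediction_mem_concentratedOn hX hs h)

theorem hasExpectedSignatures_of_isBounded (t : Fin (N + 1) → ℝ)
    (hX : AEMeasurable (pathOf X) P) (hs : MeasurableSet s) (hsb : Bornology.IsBounded s)
    (h : ∀ᵐ ω ∂P, pathOf X ω ∈ s) : HasExpectedSignatures t P ℱ X :=
  ⟨(integrable_sigOne t hsb ((ae_map_iff hX hs).2 h)).comp_aemeasurable hX,
    fun i => (ae_prediction_mem_concentratedOn hX hs h).mono fun _ hω =>
      integrable_sigOne t hsb (hω i),
    (integrable_sigTwo t hsb (ae_map_prediction_mem_concentratedOn hX hs h)).comp_measurable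
      measurable_prediction⟩

end Prediction

end RankTwoSignature

theorem theorem1_general {N d : ℕ} (t : Fin (N + 1) → ℝ) (ht0 : t 0 = 0)
    (ht : Function.Injective t)
    (K : Set (EuclideanSpace ℝ (Fin d))) (hK : Bornology.IsBounded K)
    {Ω Ω' : Type*} {mΩ : MeasurableSpace Ω} {mΩ' : MeasurableSpace Ω'}
    (P : Measure Ω) [IsProbabilityMeasure P]
    (Q : Measure Ω') [IsProbabilityMeasure Q]
    (ℱ : Filtration (Fin (N + 1)) mΩ)
    (𝒢 : Filtration (Fin (N + 1)) mΩ')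
    (X : Fin (N + 1) → Ω → EuclideanSpace ℝ (Fin d))
    (Y : Fin (N + 1) → Ω' → EuclideanSpace ℝ (Fin d))
    (hX : ∀ i, AEMeasurable (X i) P) (hY : ∀ i, AEMeasurable (Y i) Q)
    (hXK : ∀ i, ∀ᵐ ω ∂P, X i ω ∈ K) (hYK : ∀ i, ∀ᵐ ω ∂Q, Y i ω ∈ K) :
    HasExpectedSignatures t P ℱ X ∧
    HasExpectedSignatures t Q 𝒢 Y ∧
    (P.map (pathOf X) = Q.map (pathOf Y) ↔
      ∫ ω, sigOne t (pathOf X ω) ∂P =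
        ∫ ω, sigOne t (pathOf Y ω) ∂Q) ∧
    (P.map (prediction P ℱ X) = Q.map (prediction Q 𝒢 Y) ↔
      ∫ ω, sigTwo t (prediction P ℱ X ω) ∂P =
        ∫ ω, sigTwo t (prediction Q 𝒢 Y ω) ∂Q) := by
  let s : Set (PathSpace N d) := Set.univ.pi fun _ => closure K
  have hs : IsCompact s := isCompact_univ_pi fun _ => hK.isCompact_closure
  have hXs : ∀ᵐ ω ∂P, pathOf X ω ∈ s :=
    (ae_all_iff.2 hXK).mono fun ω hω i _ => subset_closure (hω i)
  have hYs : ∀ᵐ ω ∂Q, pathOf Y ω ∈ s :=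
    (ae_all_iff.2 hYK).mono fun ω hω i _ => subset_closure (hω i)
  have hXm : AEMeasurable (pathOf X) P := aemeasurable_pi_lambda _ hX
  have hYm : AEMeasurable (pathOf Y) Q := aemeasurable_pi_lambda _ hY
  refine ⟨hasExpectedSignatures_of_isBounded t hXm hs.measurableSet hs.isBounded hXs,
    hasExpectedSignatures_of_isBounded t hYm hs.measurableSet hs.isBounded hYs, ?_, ?_⟩
  · rw [eq_iff_integral_sigOne_eq ht0 ht hs ((ae_map_iff hXm hs.measurableSet).2 hXs)
        ((ae_map_iff hYm hs.measurableSet).2 hYs),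
      integral_map hXm (stronglyMeasurable_sigOne t).aestronglyMeasurable,
      integral_map hYm (stronglyMeasurable_sigOne t).aestronglyMeasurable]
  · rw [eq_iff_integral_sigTwo_eq ht0 ht hs
        (ae_map_prediction_mem_concentratedOn hXm hs.measurableSet hXs)
        (ae_map_prediction_mem_concentratedOn hYm hs.measurableSet hYs),
      integral_map measurable_prediction.aemeasurable
        (stronglyMeasurable_sigTwo t).aestronglyMeasurable,
      integral_map measurable_prediction.aemeasurable
        (stronglyMeasurable_sigTwo t).aestronglyMeasurable]

theorem theorem1 {N d : ℕ} (t : Fin (N + 1) → ℝ) (ht0 : t 0 = 0) (ht : StrictMono t)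
    (K : Set (EuclideanSpace ℝ (Fin d))) (hK : IsCompact K)
    {Ω Ω' : Type*} {mΩ : MeasurableSpace Ω} {mΩ' : MeasurableSpace Ω'}
    (P : Measure Ω) [IsProbabilityMeasure P]
    (Q : Measure Ω') [IsProbabilityMeasure Q]
    (ℱ : Filtration (Fin (N + 1)) mΩ)
    (𝒢 : Filtration (Fin (N + 1)) mΩ')
    (X : Fin (N + 1) → Ω → EuclideanSpace ℝ (Fin d))
    (Y : Fin (N + 1) → Ω' → EuclideanSpace ℝ (Fin d))
    (hX : Adapted ℱ X) (hY : Adapted 𝒢 Y)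
    (hXK : ∀ i, ∀ᵐ ω ∂P, X i ω ∈ K) (hYK : ∀ i, ∀ᵐ ω ∂Q, Y i ω ∈ K) :
    HasExpectedSignatures t P ℱ X ∧
    HasExpectedSignatures t Q 𝒢 Y ∧
    (P.map (pathOf X) = Q.map (pathOf Y) ↔
      ∫ ω, sigOne t (pathOf X ω) ∂P =
        ∫ ω, sigOne t (pathOf Y ω) ∂Q) ∧
    (P.map (prediction P ℱ X) = Q.map (prediction Q 𝒢 Y) ↔
      ∫ ω, sigTwo t (prediction P ℱ X ω) ∂P =
        ∫ ω, sigTwo t (prediction Q 𝒢 Y ω) ∂Q) :=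
  theorem1_general t ht0 ht.injective K hK.isBounded P Q ℱ 𝒢 X Y
    (fun i => ((hX i).mono (ℱ.le i) le_rfl).aemeasurable)
    (fun i => ((hY i).mono (𝒢.le i) le_rfl).aemeasurable) hXK hYK
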